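/- Let $n,k,p$ be integers with $0\le k\le n$ and $1\le p\le n-k+1$. For a partition $\mu$ let $\mathrm{SSYT}(\mu,n)$ be the set of semistandard Young tableaux of shape $\mu$ with entries in $\{1,\dots,n\}$ (rows weakly increasing, columns strictly increasing), and let $s_\mu(x_1,\dots,x_n)=\sum_{T\in\mathrm{SSYT}(\mu,n)}x^{\mathrm{wt}(T)}$ be the Schur polynomial, where $\mathrm{wt}_a(T)$ is the number of entries of $T$ equal to $a$. Put $$\overline{s}_{\mu}(x_1,\dots,x_n)=s_{\mu}\bigl((x_1+\dots+x_n)-x_1,\ \dots,\ (x_1+\dots+x_n)-x_n\bigr).$$ Then $\overline{s}_{(k)}(x_1,\dots,x_n)$ has a unique expansion as a finite integer linear combination of the Schur polynomials $s_\mu(x_1,\dots,x_n)$, with $\mu$ ranging over the partitions with at most $n$ parts, and the coefficient $[s_{(1^k)}]\,\overline{s}_{(k)}(x_1,\dots,x_n)$ of $s_{(1^k)}$ in this expansion is $$[s_{(1^k)}]\,\overline{s}_{(k)}(x_1,\dots,x_n)=\Bigl|\bigl\{S\in\mathrm{SSYT}((k),n)\ :\ S(1,1)>1,\ (S(1,i),S(1,i+1))\ne(p+i,p+i)\text{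 for all }1\le i<k\bigr\}\Bigr|,$$ where $S(1,i)$ is the $i$-th entry of the single row of $S$ (so the right-hand side counts weakly increasing sequences of length $k$ in $\{1,\dots,n\}$); for $k=0$ the condition $S(1,1)>1$ is void. -/

import Mathlib

/-- `SSYT μ n`: the semistandard Young tableaux of shape `μ` with all labels in `{1, …, n}`.
Rows and columns are numbered from `0`, as everywhere for Mathlib's Young diagrams, so the
label in row `r`, column `c` counted from `1` is `T (r - 1) (c - 1)`. -/
def SSYT (μ : YoungDiagram) (n : ℕ) : Set (SemistandardYoungTableau μ) :=
  {T | ∀ i j : ℕ, (i, j) ∈ μ → 1 ≤ T i j ∧ T i j ≤ n}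

theorem SSYT_finite (μ : YoungDiagram) (n : ℕ) : (SSYT μ n).Finite := by
  have h : Function.Injective
      (fun (T : SSYT μ n) (c : μ.cells) =>
        (⟨T.1 c.1.1 c.1.2,
          Nat.lt_succ_of_le (T.2 c.1.1 c.1.2 ((YoungDiagram.mem_cells _).1 c.2)).2⟩ :
            Fin (n + 1))) := by
    intro T T' hTT
    apply Subtype.ext
    apply SemistandardYoungTableau.ext
    intro i j
    by_cases hc : (i, j) ∈ μ
    · have := congrFun hTT ⟨(i, j), (YoungDiagram.mem_cells _).2 hc⟩
      simpa using this
    · rw [T.1.zeros hc, T'.1.zeros hc]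
  exact Set.finite_coe_iff.1 (Finite.of_injective _ h)

/-- The number of times the label `a` occurs in the tableau `T`. -/
def tableauWt {μ : YoungDiagram} (T : SemistandardYoungTableau μ) (a : ℕ) : ℕ :=
  (μ.cells.filter fun c => T c.1 c.2 = a).card

/-- The Schur polynomial `s_μ(x₁, …, xₙ)`, the sum of `x ^ wt(T)` over `T ∈ SSYT(μ, n)`.
The variable `xₐ` (`1 ≤ a ≤ n`) is `X ⟨a - 1, _⟩`. -/
noncomputable def schurPoly (n : ℕ) (μ : YoungDiagram) : MvPolynomial (Fin n) ℤ :=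
  ∑ T ∈ (SSYT_finite μ n).toFinset,
    ∏ a : Fin n, (MvPolynomial.X a : MvPolynomial (Fin n) ℤ) ^ tableauWt T ((a : ℕ) + 1)

/-- `s̄_μ(x₁, …, xₙ) = s_μ((x₁ + ⋯ + xₙ) - x₁, …, (x₁ + ⋯ + xₙ) - xₙ)`. -/
noncomputable def schurBar (n : ℕ) (μ : YoungDiagram) : MvPolynomial (Fin n) ℤ :=
  MvPolynomial.aeval
    (fun i : Fin n =>
      (∑ j : Fin n, (MvPolynomial.X j : MvPolynomial (Fin n) ℤ)) - MvPolynomial.X i)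
    (schurPoly n μ)

/-- `c` is a Schur expansion of `f(x₁, …, xₙ)`: `f` is the sum of the `c μ • s_μ(x₁, …, xₙ)`, over
the partitions `μ` with at most `n` parts (the others have zero Schur polynomial). -/
def IsSchurExpansion (n : ℕ) (f : MvPolynomial (Fin n) ℤ) (c : YoungDiagram →₀ ℤ) : Prop :=
  (∀ μ : YoungDiagram, c μ ≠ 0 → μ.colLen 0 ≤ n) ∧ f = c.sum fun μ a => a • schurPoly n μ

/-- The one-row partition `(k)`. -/
def rowShape (k : ℕ) : YoungDiagram where
  cells := {0} ×ˢ Finset.range k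
  isLowerSet := by
    rintro ⟨i, j⟩ ⟨i', j'⟩ ⟨h1, h2⟩ h
    simp only [Finset.coe_product, Set.mem_prod, Finset.mem_coe, Finset.mem_singleton,
      Finset.mem_range] at h ⊢
    simp only at h1 h2
    omega

/-- The one-column partition `(1^k)`. -/
def colShape (k : ℕ) : YoungDiagram where
  cells := Finset.range k ×ˢ {0}
  isLowerSet := by
    rintro ⟨i, j⟩ ⟨i', j'⟩ ⟨h1, h2⟩ h
    simp only [Finset.coe_product, Set.mem_prod, Finset.mem_coe, Finset.mem_singleton,
      Finset.mem_range] at h ⊢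
    simp only at h1 h2
    omega

/-- The weakly increasing sequences of length `a` with values in `{s, …, s + b}` in which no two
consecutive entries `f i`, `f (i + 1)` are both equal to `q + i`, extended by zero. -/
def avoidingSeqs (a b s q : ℕ) : Set (ℕ → ℕ) :=
  {f | (∀ i < a, s ≤ f i ∧ f i ≤ s + b) ∧ (∀ i, i + 1 < a → f i ≤ f (i + 1)) ∧
    (∀ i, a ≤ i → f i = 0) ∧ ∀ i, i + 1 < a → ¬(f i = q + i ∧ f (i + 1) = q + i)}

/-- Prepend a value to a sequence. -/
def seqCons (s : ℕ) (f : ℕ → ℕ) : ℕ → ℕ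
  | 0 => s
  | i + 1 => f i

theorem seqCons_injective (s : ℕ) : Function.Injective (seqCons s) := by
  intro f g h
  funext i
  exact congrFun h (i + 1)

theorem seqCons_tail {s : ℕ} {f : ℕ → ℕ} (h : f 0 = s) : seqCons s (fun i => f (i + 1)) = f := by
  funext i
  cases i with
  | zero => exact h.symm
  | succ i => rfl

theorem avoidingSeqs_zero (b s q : ℕ) : avoidingSeqs 0 b s q = {fun _ => 0} := by
  ext f
  simp [avoidingSeqs, funext_iff]

theorem le_of_mem_avoidingSeqs {a b s q : ℕ} {f : ℕ → ℕ} (hf : f ∈ avoidingSeqs a b s q) {i : ℕ}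
    (hi : i < a) : f 0 ≤ f i := by
  induction i with
  | zero => exact le_rfl
  | succ i ih => exact (ih (by omega)).trans (hf.2.1 i hi)

theorem avoidingSeqs_head_gt (a b s q : ℕ) :
    {f ∈ avoidingSeqs (a + 1) (b + 1) s q | f 0 ≠ s} = avoidingSeqs (a + 1) b (s + 1) q := by
  ext f
  constructor
  · rintro ⟨hf, h0⟩
    refine ⟨fun i hi => ?_, hf.2.1, hf.2.2.1, hf.2.2.2⟩
    have h1 := hf.1 i hi
    have h2 := hf.1 0 (by omega)
    have h3 := le_of_mem_avoidingSeqs hf hi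
    omega
  · intro hf
    refine ⟨⟨fun i hi => ?_, hf.2.1, hf.2.2.1, hf.2.2.2⟩, ?_⟩
    · have := hf.1 i hi
      omega
    · have := hf.1 0 (by omega)
      omega

theorem avoidingSeqs_head_gt_zero (a s q : ℕ) :
    {f ∈ avoidingSeqs (a + 1) 0 s q | f 0 ≠ s} = ∅ := by
  ext f
  simp only [Set.mem_ofPred_eq, Set.mem_empty_iff_false, iff_false, not_and, not_not]
  intro hf
  have := hf.1 0 (by omega)
  omega

theorem avoidingSeqs_head_eq (a b s q : ℕ) (h : s ≠ q ∨ a = 0) :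
    {f ∈ avoidingSeqs (a + 1) b s q | f 0 = s} = seqCons s '' avoidingSeqs a b s (q + 1) := by
  ext f
  constructor
  · rintro ⟨hf, h0⟩
    refine ⟨fun i => f (i + 1), ⟨fun i hi => hf.1 _ (by omega), fun i hi => hf.2.1 _ (by omega),
      fun i hi => hf.2.2.1 _ (by omega), fun i hi => ?_⟩, seqCons_tail h0⟩
    have := hf.2.2.2 (i + 1) (by omega)
    rwa [← add_assoc, add_right_comm] at this
  · rintro ⟨g, hg, rfl⟩
    refine ⟨⟨?_, ?_, ?_, ?_⟩, rfl⟩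
    · rintro (_ | i) hi
      · simp [seqCons]
      · exact hg.1 i (by omega)
    · rintro (_ | i) hi
      · exact (hg.1 0 (by omega)).1
      · exact hg.2.1 i (by omega)
    · rintro (_ | i) hi
      · omega
      · exact hg.2.2.1 i (by omega)
    · rintro (_ | i) hi
      · simp only [seqCons]
        omega
      · have := hg.2.2.2 i (by omega)
        simp only [seqCons]
        rwa [← add_assoc, add_right_comm]

theorem avoidingSeqs_head_eq_self (a b s : ℕ) :
    {f ∈ avoidingSeqs (a + 2) (b + 1) s s | f 0 = s} =
      seqCons s '' avoidingSeqs (a + 1) b (s + 1) (s + 1) := by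
  ext f
  constructor
  · rintro ⟨hf, h0⟩
    have h1 := hf.2.2.2 0 (by omega)
    have h2 := hf.2.1 0 (by omega)
    have h3 : ∀ i, i < a + 1 → f 1 ≤ f (i + 1) := by
      intro i
      induction i with
      | zero => exact fun _ => le_rfl
      | succ i ih => exact fun hi => (ih (by omega)).trans (hf.2.1 (i + 1) (by omega))
    refine ⟨fun i => f (i + 1), ⟨fun i hi => ?_, fun i hi => hf.2.1 _ (by omega),
      fun i hi => hf.2.2.1 _ (by omega), fun i hi => ?_⟩, seqCons_tail h0⟩
    · have := hf.1 (i + 1) (by omega)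
      have := h3 i hi
      simp only [zero_add, add_zero] at h1 h2 ⊢
      omega
    · have := hf.2.2.2 (i + 1) (by omega)
      rwa [← add_assoc, add_right_comm] at this
  · rintro ⟨g, hg, rfl⟩
    refine ⟨⟨?_, ?_, ?_, ?_⟩, rfl⟩
    · rintro (_ | i) hi
      · simp [seqCons]
      · have := hg.1 i (by omega)
        simp only [seqCons]
        omega
    · rintro (_ | i) hi
      · have := hg.1 0 (by omega)
        simp only [seqCons]
        omega
      · exact hg.2.1 i (by omega)
    · rintro (_ | i) hi
      · omega
      · exact hg.2.2.1 i (by omega)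
    · rintro (_ | i) hi
      · have := hg.1 0 (by omega)
        simp only [seqCons]
        omega
      · have := hg.2.2.2 i (by omega)
        simp only [seqCons]
        rwa [← add_assoc, add_right_comm]

theorem avoidingSeqs_head_eq_self_zero (a s : ℕ) :
    {f ∈ avoidingSeqs (a + 2) 0 s s | f 0 = s} = ∅ := by
  ext f
  simp only [Set.mem_ofPred_eq, Set.mem_empty_iff_false, iff_false, not_and]
  intro hf _
  have h0 := hf.1 0 (by omega)
  have h1 := hf.1 1 (by omega)
  exact hf.2.2.2 0 (by omega) ⟨by omega, by simp only [zero_add, add_zero]; omega⟩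

/-- The number of sequences of length `a` with values in `{s, …, s + b}` excluded from
`avoidingSeqs a b s q`, as a function of `d = s - q`. -/
def excludedCount (a b d : ℕ) : ℕ := if 2 + d ≤ a then (a + b).choose (a - 2 - d) else 0

theorem excludedCount_succ_zero (a b : ℕ) :
    excludedCount (a + 1) (b + 1) 0 = excludedCount (a + 1) b 0 + excludedCount a (b + 1) 0 := by
  rcases a with _ | _ | a
  · simp [excludedCount]
  · simp [excludedCount]
  · simp only [excludedCount]
    rw [if_pos (by omega), if_pos (by omega), if_pos (by omega)]
    have e1 : a + 1 + 1 + 1 - 2 - 0 = a + 1 := by omega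
    have e2 : a + 1 + 1 - 2 - 0 = a := by omega
    rw [e1, e2, show a + 1 + 1 + 1 + (b + 1) = (a + b + 3) + 1 by ring,
      show a + 1 + 1 + 1 + b = a + b + 3 by ring, show a + 1 + 1 + (b + 1) = a + b + 3 by ring,
      Nat.choose_succ_succ, add_comm]

theorem excludedCount_succ_succ (a b d : ℕ) :
    excludedCount (a + 1) (b + 1) (d + 1) =
      excludedCount (a + 1) b (d + 2) + excludedCount a (b + 1) d := by
  simp only [excludedCount]
  rcases lt_trichotomy a (2 + d) with h | rfl | h
  · rw [if_neg (by omega), if_neg (by omega), if_neg (by omega)]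
  · rw [if_pos (by omega), if_neg (by omega), if_pos (by omega),
      show 2 + d + 1 - 2 - (d + 1) = 0 by omega, show 2 + d - 2 - d = 0 by omega]
    simp
  · rw [if_pos (by omega), if_pos (by omega), if_pos (by omega)]
    obtain ⟨e, rfl⟩ := Nat.exists_eq_add_of_lt h
    rw [show 2 + d + e + 1 + 1 - 2 - (d + 1) = e + 1 by omega,
      show 2 + d + e + 1 + 1 - 2 - (d + 2) = e by omega,
      show 2 + d + e + 1 - 2 - d = e + 1 by omega,
      show 2 + d + e + 1 + 1 + (b + 1) = (2 + d + e + 1 + 1 + b) + 1 by ring,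
      show 2 + d + e + 1 + (b + 1) = 2 + d + e + 1 + 1 + b by ring, Nat.choose_succ_succ]

theorem excludedCount_diag (a b : ℕ) :
    excludedCount (a + 2) (b + 1) 0 = excludedCount (a + 2) b 1 + excludedCount (a + 1) b 0 +
      (a + 1 + b).choose a := by
  simp only [excludedCount]
  rcases a with _ | a
  · simp
  · rw [if_pos (by omega), if_pos (by omega), if_pos (by omega),
      show a + 1 + 2 - 2 - 0 = a + 1 by omega, show a + 1 + 2 - 2 - 1 = a by omega,
      show a + 1 + 1 - 2 - 0 = a by omega, show a + 1 + 2 + (b + 1) = (a + b + 2) + 1 + 1 by ring,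
      show a + 1 + 2 + b = (a + b + 2) + 1 by ring, show a + 1 + 1 + b = a + b + 2 by ring,
      Nat.choose_succ_succ (a + b + 2 + 1), Nat.choose_succ_succ (a + b + 2) a]
    ring

theorem avoidingSeqs_split {a b s q x y : ℕ} {A B : Set (ℕ → ℕ)}
    (hA : {f ∈ avoidingSeqs a b s q | f 0 ≠ s} = A) (hB : {f ∈ avoidingSeqs a b s q | f 0 = s} = B)
    (hAc : A.Finite ∧ A.ncard = x) (hBc : B.Finite ∧ B.ncard = y) :
    (avoidingSeqs a b s q).Finite ∧ (avoidingSeqs a b s q).ncard = x + y := by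
  have hU : avoidingSeqs a b s q = A ∪ B := by
    rw [← hA, ← hB]
    ext f
    simp only [Set.mem_union, Set.mem_ofPred_eq]
    tauto
  have hd : Disjoint A B := by
    rw [← hA, ← hB, Set.disjoint_left]
    exact fun f hf hg => hf.2 hg.2
  rw [hU]
  exact ⟨hAc.1.union hBc.1, by rw [Set.ncard_union_eq hd hAc.1 hBc.1, hAc.2, hBc.2]⟩

theorem finite_ncard_seqCons {s x : ℕ} {A : Set (ℕ → ℕ)} (h : A.Finite ∧ A.ncard = x) :
    (seqCons s '' A).Finite ∧ (seqCons s '' A).ncard = x :=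
  ⟨h.1.image _, by rw [Set.ncard_image_of_injective _ (seqCons_injective s), h.2]⟩

theorem ncard_avoidingSeqs (a b s q : ℕ) (h : q + a ≤ s + b + 2) :
    (avoidingSeqs a b s q).Finite ∧
      (avoidingSeqs a b s q).ncard + excludedCount a b (s - q) = (a + b).choose a := by
  induction a generalizing b s q with
  | zero => simp [avoidingSeqs_zero, excludedCount]
  | succ a iha =>
    induction b generalizing s with
    | zero =>
      have key : ∀ {y : ℕ} {B : Set (ℕ → ℕ)},
          {f ∈ avoidingSeqs (a + 1) 0 s q | f 0 = s} = B → B.Finite ∧ B.ncard = y →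
          (avoidingSeqs (a + 1) 0 s q).Finite ∧ (avoidingSeqs (a + 1) 0 s q).ncard = 0 + y :=
        fun hB h => avoidingSeqs_split (avoidingSeqs_head_gt_zero a s q) hB (by simp) h
      by_cases hsq : s ≠ q ∨ a = 0
      · have h1 := iha 0 s (q + 1) (by omega)
        obtain ⟨hf, hc⟩ := key (avoidingSeqs_head_eq a 0 s q hsq) (finite_ncard_seqCons ⟨h1.1, rfl⟩)
        refine ⟨hf, ?_⟩
        have h2 := h1.2
        rw [add_zero, Nat.choose_self] at h2 ⊢
        suffices hB : excludedCount (a + 1) 0 (s - q) = excludedCount a 0 (s - (q + 1)) by omega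
        simp only [excludedCount]
        rcases le_or_gt s q with hle | hlt
        · rw [if_neg (by omega), if_neg (by omega)]
        · by_cases h3 : 2 + (s - q) ≤ a + 1
          · rw [if_pos h3, if_pos (by omega), show a + 1 - 2 - (s - q) = 0 by omega,
              show a - 2 - (s - (q + 1)) = 0 by omega]
            simp
          · rw [if_neg h3, if_neg (by omega)]
      · push Not at hsq
        obtain ⟨rfl, ha⟩ := hsq
        obtain rfl : a = 1 := by omega
        obtain ⟨hf, hc⟩ := key (avoidingSeqs_head_eq_self_zero 0 s) (y := 0) (by simp)
        refine ⟨hf, ?_⟩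
        rw [hc]
        simp [excludedCount]
    | succ b ihb =>
      have h1 := ihb (s + 1) (by omega)
      have hp : (a + 1 + (b + 1)).choose (a + 1) =
          (a + (b + 1)).choose a + (a + 1 + b).choose (a + 1) := by
        rw [show a + 1 + (b + 1) = (a + 1 + b) + 1 by ring, show a + (b + 1) = a + 1 + b by ring,
          Nat.choose_succ_succ]
      by_cases hsq : s ≠ q ∨ a = 0
      · have h2 := iha (b + 1) s (q + 1) (by omega)
        obtain ⟨hf, hc⟩ := avoidingSeqs_split (avoidingSeqs_head_gt a b s q)
          (avoidingSeqs_head_eq a (b + 1) s q hsq) ⟨h1.1, rfl⟩ (finite_ncard_seqCons ⟨h2.1, rfl⟩)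
        refine ⟨hf, ?_⟩
        have hB : excludedCount (a + 1) (b + 1) (s - q) =
            excludedCount (a + 1) b (s + 1 - q) + excludedCount a (b + 1) (s - (q + 1)) := by
          rcases lt_trichotomy s q with hlt | rfl | hlt
          · rw [show s - q = 0 by omega, show s + 1 - q = 0 by omega,
              show s - (q + 1) = 0 by omega, excludedCount_succ_zero]
          · obtain rfl : a = 0 := by simpa using hsq
            simp only [excludedCount]
            rw [if_neg (by omega), if_neg (by omega), if_neg (by omega)]
          · obtain ⟨d, rfl⟩ := Nat.exists_eq_add_of_lt hlt
            rw [show q + d + 1 - q = d + 1 by omega, show q + d + 1 + 1 - q = d + 2 by omega,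
              show q + d + 1 - (q + 1) = d by omega, excludedCount_succ_succ]
        omega
      · push Not at hsq
        obtain ⟨rfl, ha⟩ := hsq
        obtain ⟨a, rfl⟩ := Nat.exists_eq_succ_of_ne_zero ha
        have h2 := iha b (s + 1) (s + 1) (by omega)
        obtain ⟨hf, hc⟩ := avoidingSeqs_split (avoidingSeqs_head_gt (a + 1) b s s)
          (avoidingSeqs_head_eq_self a b s) ⟨h1.1, rfl⟩ (finite_ncard_seqCons ⟨h2.1, rfl⟩)
        refine ⟨hf, ?_⟩
        have hB := excludedCount_diag a b
        have hq : (a + 1 + (b + 1)).choose (a + 1) =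
            (a + 1 + b).choose a + (a + 1 + b).choose (a + 1) := by
          rw [← add_assoc, Nat.choose_succ_succ]
        simp only [Nat.succ_eq_add_one, Nat.sub_self, show s + 1 - s = 1 by omega] at *
        simp only [add_assoc, Nat.reduceAdd] at *
        omega

section GelfandTsetlin

variable {R : Type*} [CommRing R]

/-- The arrays `g` of length `n` interlacing with the array `f` of length `n + 1`. -/
def interlacing {n : ℕ} (f : Fin (n + 1) → ℕ) : Finset (Fin n → ℕ) :=
  Finset.Icc (fun i => f i.succ) (fun i => f i.castSucc)

theorem mem_interlacing {n : ℕ} {f : Fin (n + 1) → ℕ} {g : Fin n → ℕ} :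
    g ∈ interlacing f ↔ ∀ i, f i.succ ≤ g i ∧ g i ≤ f i.castSucc := by
  simp only [interlacing, Finset.mem_Icc, Pi.le_def]
  exact ⟨fun h i => ⟨h.1 i, h.2 i⟩, fun h => ⟨fun i => (h i).1, fun i => (h i).2⟩⟩

/-- The generating function of the Gelfand–Tsetlin patterns with top row `f`. -/
noncomputable def gelfandTsetlin (x : ℕ → R) : (n : ℕ) → (Fin n → ℕ) → R
  | 0, _ => 1
  | n + 1, f => ∑ g ∈ interlacing f,
      x (n + 1) ^ (∑ i, f i - ∑ i, g i) * gelfandTsetlin x n g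

theorem antitone_of_interlacing_nonempty {n : ℕ} {f : Fin (n + 1) → ℕ}
    (h : (interlacing f).Nonempty) : Antitone f := by
  obtain ⟨g, hg⟩ := h
  rw [mem_interlacing] at hg
  exact Fin.antitone_iff_succ_le.2 fun i => (hg i).1.trans (hg i).2

theorem antitone_of_mem_interlacing {n : ℕ} {f : Fin (n + 1) → ℕ} {g : Fin n → ℕ}
    (hg : g ∈ interlacing f) : Antitone g := by
  rw [mem_interlacing] at hg
  cases n with
  | zero => exact fun i => i.elim0
  | succ n =>
    refine Fin.antitone_iff_succ_le.2 fun i => (hg i.succ).2.trans ?_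
    have := (hg i.castSucc).1
    rwa [Fin.succ_castSucc] at this

theorem gelfandTsetlin_eq_zero (x : ℕ → R) {n : ℕ} {f : Fin n → ℕ} (hf : ¬Antitone f) :
    gelfandTsetlin x n f = 0 := by
  cases n with
  | zero => exact absurd (fun i => i.elim0) hf
  | succ n =>
    have : interlacing f = ∅ := by
      by_contra h
      exact hf (antitone_of_interlacing_nonempty (Finset.nonempty_iff_ne_empty.2 h))
    simp [gelfandTsetlin, this]

theorem sum_le_of_mem_interlacing {n : ℕ} {f : Fin (n + 1) → ℕ} {g : Fin n → ℕ}
    (hg : g ∈ interlacing f) : ∑ i, g i ≤ ∑ i, f i := by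
  rw [Fin.sum_univ_castSucc]
  exact (Finset.sum_le_sum fun i _ => (mem_interlacing.1 hg i).2).trans (Nat.le_add_right _ _)

theorem interlacing_add_single_succ {n : ℕ} {f : Fin (n + 1) → ℕ} {g : Fin n → ℕ}
    (hg : g ∈ interlacing f) (j : Fin n) :
    g ∈ interlacing (f + Pi.single j.succ 1) ↔
      ∀ k, f k.succ + (Pi.single j 1 : Fin n → ℕ) k ≤ g k ∧
        g k ≤ f k.castSucc + (Pi.single j 1 : Fin n → ℕ) k := by
  simp only [mem_interlacing, Pi.add_apply, Pi.single_apply, Fin.succ_inj] at hg ⊢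
  refine forall_congr' fun k => ?_
  have := hg k
  split_ifs <;> omega

theorem interlacing_add_single_castSucc {n : ℕ} {f : Fin (n + 1) → ℕ} {g : Fin n → ℕ}
    (hf : Antitone f) (hga : Antitone g) (hg : g ∉ interlacing f) (j : Fin n) :
    g ∈ interlacing (f + Pi.single j.castSucc 1) ↔
      ∀ k, f k.succ + (Pi.single j 1 : Fin n → ℕ) k ≤ g k ∧
        g k ≤ f k.castSucc + (Pi.single j 1 : Fin n → ℕ) k := by
  simp only [mem_interlacing, Pi.add_apply, Pi.single_apply, Fin.castSucc_inj] at hg ⊢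
  have hj := hf (Fin.castSucc_lt_succ (i := j)).le
  constructor
  · intro h
    have h1 : g j = f j.castSucc + 1 := by
      by_contra hne
      refine hg fun k => ?_
      have hk := h k
      by_cases hkj : k = j
      · subst hkj
        simp only [if_true] at hk
        omega
      · rw [if_neg hkj] at hk
        omega
    intro k
    have hk := h k
    by_cases hkj : k = j
    · subst hkj
      simp only [if_true] at hk ⊢
      omega
    · rw [if_neg hkj] at hk ⊢
      omega
  · intro h
    have h1 : g j = f j.castSucc + 1 := by
      by_contra hne
      refine hg fun k => ?_
      have hk := h k
      by_cases hkj : k = j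
      · subst hkj
        simp only [if_true] at hk
        omega
      · rw [if_neg hkj] at hk
        omega
    intro k
    have hk := h k
    by_cases hkj : k = j
    · subst hkj
      have : k.succ ≠ k.castSucc := (Fin.castSucc_lt_succ (i := k)).ne'
      simp only [if_true, if_neg this] at hk ⊢
      omega
    · rw [if_neg hkj] at hk ⊢
      by_cases hkj' : k.succ = j.castSucc
      · have : g j ≤ g k := hga (by
          rw [Fin.ext_iff] at hkj'
          simp only [Fin.val_succ, Fin.val_castSucc] at hkj'
          exact Fin.le_def.2 (by omega))
        rw [if_pos hkj', hkj']
        omega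
      · rw [if_neg hkj']
        omega

theorem sum_interlacing_add_single {n : ℕ} {f : Fin (n + 1) → ℕ} (hf : Antitone f)
    (F : (Fin n → ℕ) → R) (hF : ∀ g, ¬Antitone g → F g = 0) :
    ∑ i, ∑ g ∈ interlacing (f + Pi.single i 1), F g =
      ∑ j, ∑ g ∈ interlacing f, F (g + Pi.single j 1) + ∑ g ∈ interlacing f, F g := by
  set K : Finset (Fin n → ℕ) := Finset.Icc 0 (fun i => f i.castSucc + 1) with hK
  have hsub : ∀ (I : Finset (Fin n → ℕ)), (∀ g ∈ I, ∀ k, g k ≤ f k.castSucc + 1) →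
      ∀ (P : (Fin n → ℕ) → Prop) [DecidablePred P], (∀ g, g ∈ I ↔ P g) →
      ∑ g ∈ I, F g = ∑ g ∈ K, if P g then F g else 0 := by
    intro I hI P _ hP
    rw [← Finset.sum_filter]
    congr 1
    ext g
    simp only [Finset.mem_filter, hK, Finset.mem_Icc, hP]
    exact ⟨fun h => ⟨⟨fun _ => Nat.zero_le _, hI g ((hP g).2 h)⟩, h⟩, fun h => h.2⟩
  have h1 : ∀ i, ∑ g ∈ interlacing (f + Pi.single i 1), F g =
      ∑ g ∈ K, if g ∈ interlacing (f + Pi.single i 1) then F g else 0 := by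
    refine fun i => hsub _ (fun g hg k => ?_) _ fun g => Iff.rfl
    have := (mem_interlacing.1 hg k).2
    simp only [Pi.add_apply, Pi.single_apply] at this
    split_ifs at this <;> omega
  have h2 : ∑ g ∈ interlacing f, F g = ∑ g ∈ K, if g ∈ interlacing f then F g else 0 := by
    refine hsub _ (fun g hg k => ?_) _ fun g => Iff.rfl
    have := (mem_interlacing.1 hg k).2
    omega
  have h3 : ∀ j : Fin n, ∑ g ∈ interlacing f, F (g + Pi.single j 1) =
      ∑ g ∈ K, if ∀ k, f k.succ + (Pi.single j 1 : Fin n → ℕ) k ≤ g k ∧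
        g k ≤ f k.castSucc + (Pi.single j 1 : Fin n → ℕ) k then F g else 0 := by
    intro j
    have hm : ∀ g, g ∈ (interlacing f).map (addRightEmbedding (Pi.single j 1)) ↔
        ∀ k, f k.succ + (Pi.single j 1 : Fin n → ℕ) k ≤ g k ∧
        g k ≤ f k.castSucc + (Pi.single j 1 : Fin n → ℕ) k := by
      intro g
      rw [interlacing, Finset.map_add_right_Icc, Finset.mem_Icc]
      simp only [Pi.le_def, Pi.add_apply]
      exact ⟨fun h i => ⟨h.1 i, h.2 i⟩, fun h => ⟨fun i => (h i).1, fun i => (h i).2⟩⟩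
    rw [← hsub ((interlacing f).map (addRightEmbedding (Pi.single j 1))) _ _ hm]
    · simp
    · intro g hg k
      have := ((hm g).1 hg k).2
      simp only [Pi.single_apply] at this
      split_ifs at this <;> omega
  simp only [h1, h2, h3]
  rw [Finset.sum_comm, Finset.sum_comm (s := Finset.univ) (t := K), ← Finset.sum_add_distrib]
  refine Finset.sum_congr rfl fun g _ => ?_
  by_cases hga : Antitone g
  · by_cases hg : g ∈ interlacing f
    · rw [Fin.sum_univ_succ, if_pos hg, add_comm]
      congr 1
      · refine Finset.sum_congr rfl fun j _ => ?_
        simp only [interlacing_add_single_succ hg j]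
      · rw [if_pos]
        rw [mem_interlacing] at hg ⊢
        intro k
        have := hg k
        simp only [Pi.add_apply, Pi.single_apply, Fin.succ_ne_zero, if_false]
        split_ifs <;> omega
    · rw [Fin.sum_univ_castSucc, if_neg hg]
      congr 1
      · refine Finset.sum_congr rfl fun j _ => ?_
        simp only [interlacing_add_single_castSucc hf hga hg j]
      · rw [if_neg]
        intro h
        refine hg (mem_interlacing.2 fun k => ?_)
        have := mem_interlacing.1 h k
        simp only [Pi.add_apply, Pi.single_apply, (Fin.castSucc_lt_last k).ne, if_false] at this
        omega
  · simp [hF g hga]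

/-- Pieri's rule for multiplication by `x₁ + ⋯ + xₙ`. -/
theorem sum_gelfandTsetlin_add_single (x : ℕ → R) (n : ℕ) {f : Fin n → ℕ} (hf : Antitone f) :
    ∑ i, gelfandTsetlin x n (f + Pi.single i 1) =
      (∑ i : Fin n, x (i + 1)) * gelfandTsetlin x n f := by
  induction n with
  | zero => simp
  | succ n ih =>
    have hsum : ∀ {m : ℕ} (h : Fin m → ℕ) (i : Fin m),
        ∑ k, (h + Pi.single i 1 : Fin m → ℕ) k = ∑ k, h k + 1 := by
      intro m h i
      simp [Finset.sum_add_distrib]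
    simp only [gelfandTsetlin, hsum]
    rw [sum_interlacing_add_single hf
      (fun g => x (n + 1) ^ (∑ i, f i + 1 - ∑ i, g i) * gelfandTsetlin x n g)
      (fun g hg => by rw [gelfandTsetlin_eq_zero x hg, mul_zero]), Finset.sum_comm,
      Fin.sum_univ_castSucc (fun i : Fin (n + 1) => x (i + 1)), add_mul, Finset.mul_sum, Finset.mul_sum]
    congr 1
    · refine Finset.sum_congr rfl fun g hg => ?_
      simp only [hsum, Nat.add_sub_add_right, Fin.val_castSucc]
      rw [← Finset.mul_sum, ih (antitone_of_mem_interlacing hg)]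
      ring
    · refine Finset.sum_congr rfl fun g hg => ?_
      rw [Nat.sub_add_comm (sum_le_of_mem_interlacing hg), pow_succ, Fin.val_last]
      ring

/-- The complete homogeneous symmetric polynomial of degree `k` in `x₁, …, xₙ`. -/
noncomputable def completeHom (x : ℕ → R) : ℕ → ℕ → R
  | 0, k => if k = 0 then 1 else 0
  | n + 1, k => ∑ j ∈ Finset.range (k + 1), x (n + 1) ^ (k - j) * completeHom x n j

theorem completeHom_zero_right (x : ℕ → R) (n : ℕ) : completeHom x n 0 = 1 := by
  induction n with
  | zero => simp [completeHom]
  | succ n ih => simp [completeHom, ih]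

theorem completeHom_succ_succ (x : ℕ → R) (n k : ℕ) :
    completeHom x (n + 1) (k + 1) =
      completeHom x n (k + 1) + x (n + 1) * completeHom x (n + 1) k := by
  simp only [completeHom]
  rw [Finset.sum_range_succ, Finset.mul_sum, add_comm]
  congr 1
  · simp
  · refine Finset.sum_congr rfl fun j hj => ?_
    rw [Nat.sub_add_comm (Nat.lt_succ_iff.1 (Finset.mem_range.1 hj)), pow_succ]
    ring

/-- The partition `(k)` as an array of length `n`. -/
def rowArray (n k : ℕ) : Fin n → ℕ := fun i => if i.val = 0 then k else 0

theorem gelfandTsetlin_rowArray (x : ℕ → R) (n k : ℕ) :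
    gelfandTsetlin x (n + 1) (rowArray (n + 1) k) = completeHom x (n + 1) k := by
  have hs : ∀ m l, ∑ i, rowArray (m + 1) l i = l := by
    intro m l
    simp [rowArray]
  induction n generalizing k with
  | zero =>
    have : ∑ i, rowArray (0 + 1) k i = k := hs 0 k
    have hI : interlacing (rowArray (0 + 1) k) = {Fin.elim0} := by
      ext g
      simp [mem_interlacing, eq_iff_true_of_subsingleton]
    simp only [gelfandTsetlin, completeHom, hI, this]
    rw [Finset.sum_singleton, Finset.sum_eq_single (0 : ℕ)]
    · simp
    · intro b _ hb
      simp [hb]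
    · simp
  | succ n ih =>
    rw [gelfandTsetlin, completeHom]
    symm
    refine Finset.sum_nbij (rowArray (n + 1)) ?_ ?_ ?_ ?_
    · intro j hj
      rw [Finset.mem_range] at hj
      refine mem_interlacing.2 fun i => ?_
      simp only [rowArray, Fin.val_succ, Fin.val_castSucc]
      rw [if_neg (Nat.succ_ne_zero _)]
      split_ifs <;> omega
    · intro a _ b _ hab
      simpa [rowArray] using congrFun hab 0
    · intro g hg
      have hg := mem_interlacing.1 hg
      refine ⟨g 0, ?_, ?_⟩
      · have := (hg 0).2
        simp only [rowArray, Fin.val_castSucc, Fin.val_zero, if_true] at this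
        simp only [Finset.coe_range, Set.mem_Iio]
        omega
      · funext i
        have := (hg i).2
        simp only [rowArray, Fin.val_castSucc] at this ⊢
        split_ifs at this ⊢ with hi
        · rw [show i = 0 from Fin.ext hi]
        · omega
    · intro j hj
      rw [hs, hs, ih]

theorem completeHom_sub (x : ℕ → R) (t : R) (n k : ℕ) :
    completeHom (fun i => t - x i) n k =
      ∑ j ∈ Finset.range (k + 1),
        (-1) ^ j * ((n + k - 1).choose (k - j) : R) * t ^ (k - j) * completeHom x n j := by
  induction n generalizing k with
  | zero =>
    rw [Finset.sum_range_succ', Finset.sum_eq_zero]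
    · cases k with
      | zero => simp [completeHom]
      | succ k => simp [completeHom]
    · intro j _
      simp [completeHom]
  | succ n ihn =>
    induction k with
    | zero => simp [completeHom_zero_right]
    | succ k ihk =>
      rw [completeHom_succ_succ, ihn, ihk, sub_mul]
      have hx : ∑ j ∈ Finset.range (k + 1 + 1), (-1) ^ j * ((n + k).choose (k + 1 - j) : R) *
            t ^ (k + 1 - j) * completeHom x (n + 1) j =
          ∑ j ∈ Finset.range (k + 1 + 1), (-1) ^ j * ((n + k).choose (k + 1 - j) : R) *
            t ^ (k + 1 - j) * completeHom x n j - x (n + 1) *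
          ∑ j ∈ Finset.range (k + 1), (-1) ^ j * ((n + k).choose (k - j) : R) * t ^ (k - j) *
            completeHom x (n + 1) j := by
        rw [Finset.sum_range_succ' _ (k + 1), Finset.sum_range_succ' _ (k + 1), Finset.mul_sum,
          add_sub_right_comm, ← Finset.sum_sub_distrib]
        congr 1
        · refine Finset.sum_congr rfl fun j _ => ?_
          rw [completeHom_succ_succ, Nat.add_sub_add_right]
          ring
        · simp [completeHom_zero_right]
      have ht : ∑ j ∈ Finset.range (k + 1 + 1), (-1) ^ j * ((n + k + 1).choose (k + 1 - j) : R) *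
            t ^ (k + 1 - j) * completeHom x (n + 1) j =
          t * ∑ j ∈ Finset.range (k + 1), (-1) ^ j * ((n + k).choose (k - j) : R) * t ^ (k - j) *
            completeHom x (n + 1) j +
          ∑ j ∈ Finset.range (k + 1 + 1), (-1) ^ j * ((n + k).choose (k + 1 - j) : R) *
            t ^ (k + 1 - j) * completeHom x (n + 1) j := by
        rw [Finset.sum_range_succ _ (k + 1), Finset.sum_range_succ _ (k + 1), Finset.mul_sum,
          ← add_assoc, ← Finset.sum_add_distrib]
        congr 1
        · refine Finset.sum_congr rfl fun j hj => ?_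
          rw [Nat.sub_add_comm (Nat.lt_succ_iff.1 (Finset.mem_range.1 hj)), Nat.choose_succ_succ,
            pow_succ]
          push_cast
          ring
        · simp
      rw [show n + 1 + (k + 1) - 1 = n + k + 1 by omega, show n + (k + 1) - 1 = n + k by omega,
        show n + 1 + k - 1 = n + k by omega, ht, hx]
      ring

end GelfandTsetlin

section ArrayDiagram

/-- The Young diagram with row lengths given by the array `f`, for antitone `f`. -/
def arrayDiagram {n : ℕ} (f : Fin n → ℕ) : YoungDiagram where
  cells := (Finset.range n ×ˢ Finset.range (∑ i, f i)).filter
    fun c => ∀ i : Fin n, i.val ≤ c.1 → c.2 < f i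
  isLowerSet := by
    rintro ⟨i, j⟩ ⟨i', j'⟩ ⟨h1, h2⟩ h
    simp only [Finset.coe_filter, Finset.mem_product, Finset.mem_range, Set.mem_ofPred_eq] at h ⊢
    simp only at h1 h2
    exact ⟨⟨by omega, by omega⟩, fun k hk => h2.trans_lt (h.2 k (by omega))⟩

theorem mem_arrayDiagram {n : ℕ} {f : Fin n → ℕ} (hf : Antitone f) {i j : ℕ} :
    (i, j) ∈ arrayDiagram f ↔ ∃ h : i < n, j < f ⟨i, h⟩ := by
  rw [← YoungDiagram.mem_cells]
  simp only [arrayDiagram, Finset.mem_filter, Finset.mem_product, Finset.mem_range]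
  constructor
  · exact fun h => ⟨h.1.1, h.2 ⟨i, h.1.1⟩ le_rfl⟩
  · rintro ⟨h, hj⟩
    exact ⟨⟨h, hj.trans_le (Finset.single_le_sum (fun _ _ => Nat.zero_le _) (Finset.mem_univ _))⟩,
      fun k hk => hj.trans_le (hf hk)⟩

theorem rowLen_arrayDiagram {n : ℕ} {f : Fin n → ℕ} (hf : Antitone f) (i : Fin n) :
    (arrayDiagram f).rowLen i = f i := by
  refine le_antisymm (le_of_forall_lt fun j hj => ?_) (le_of_forall_lt fun j hj => ?_)
  · exact ((mem_arrayDiagram hf).1 (YoungDiagram.mem_iff_lt_rowLen.2 hj)).2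
  · exact YoungDiagram.mem_iff_lt_rowLen.1 ((mem_arrayDiagram hf).2 ⟨i.2, hj⟩)

theorem arrayDiagram_rowLen {n : ℕ} {μ : YoungDiagram} (h : μ.colLen 0 ≤ n) :
    arrayDiagram (fun i : Fin n => μ.rowLen i) = μ := by
  refine SetLike.ext fun c => ?_
  rw [← Prod.mk.eta (p := c), mem_arrayDiagram (fun i j hij => μ.rowLen_anti _ _ hij),
    YoungDiagram.mem_iff_lt_rowLen]
  refine ⟨fun h => h.2, fun hc => ⟨?_, hc⟩⟩
  exact (YoungDiagram.mem_iff_lt_colLen.1 (μ.up_left_mem le_rfl (Nat.zero_le _)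
    (YoungDiagram.mem_iff_lt_rowLen.2 hc))).trans_le h

theorem card_arrayDiagram {n : ℕ} {f : Fin n → ℕ} (hf : Antitone f) :
    (arrayDiagram f).cells.card = ∑ i, f i := by
  rw [Finset.card_eq_sum_card_fiberwise (f := Prod.fst) (t := Finset.range n), Finset.sum_range]
  · refine Finset.sum_congr rfl fun i _ => ?_
    rw [← rowLen_arrayDiagram hf i, YoungDiagram.rowLen_eq_card]
    rfl
  · intro c hc
    exact Finset.mem_coe.2 (Finset.mem_range.2
      ((mem_arrayDiagram hf (i := c.1) (j := c.2)).1 ((YoungDiagram.mem_cells c).1 hc)).1)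

end ArrayDiagram

section Branching

theorem succ_le_of_mem_SSYT {μ : YoungDiagram} {n : ℕ} {T : SemistandardYoungTableau μ}
    (hT : T ∈ SSYT μ n) {i j : ℕ} (h : (i, j) ∈ μ) : i + 1 ≤ T i j := by
  induction i with
  | zero => exact (hT 0 j h).1
  | succ i ih =>
    have := ih (μ.up_left_mem (Nat.le_succ i) le_rfl h)
    have := T.col_strict (Nat.lt_add_one i) h
    omega

/-- The part of a tableau inside a smaller shape. -/
def SemistandardYoungTableau.restrict {μ ν : YoungDiagram} (h : ν ≤ μ)
    (T : SemistandardYoungTableau μ) : SemistandardYoungTableau ν where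
  entry i j := if (i, j) ∈ ν then T i j else 0
  row_weak' := by
    intro i j1 j2 hj hc
    rw [if_pos hc, if_pos (ν.up_left_mem le_rfl hj.le hc)]
    exact T.row_weak hj (h hc)
  col_strict' := by
    intro i1 i2 j hi hc
    rw [if_pos hc, if_pos (ν.up_left_mem hi.le le_rfl hc)]
    exact T.col_strict hi (h hc)
  zeros' := fun hc => if_neg hc

theorem SemistandardYoungTableau.restrict_apply {μ ν : YoungDiagram} (h : ν ≤ μ)
    (T : SemistandardYoungTableau μ) (i j : ℕ) :
    T.restrict h i j = if (i, j) ∈ ν then T i j else 0 := rfl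

/-- Extend a tableau with labels in `{1, …, n}` by the label `n + 1` on a horizontal strip. -/
def SemistandardYoungTableau.extend {μ ν : YoungDiagram} {n : ℕ}
    (hs : ∀ i j, (i + 1, j) ∈ μ → (i, j) ∈ ν)
    (T : SemistandardYoungTableau ν) (hT : T ∈ SSYT ν n) : SemistandardYoungTableau μ where
  entry i j := if (i, j) ∈ μ then (if (i, j) ∈ ν then T i j else n + 1) else 0
  row_weak' := by
    intro i j1 j2 hj hc
    rw [if_pos hc, if_pos (μ.up_left_mem le_rfl hj.le hc)]
    split_ifs with h1 h2 h2
    · exact T.row_weak hj h2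
    · exact (hT _ _ h1).2.trans (Nat.le_succ n)
    · exact absurd (ν.up_left_mem le_rfl hj.le h2) h1
    · exact le_rfl
  col_strict' := by
    intro i1 i2 j hi hc
    obtain ⟨i, rfl⟩ : ∃ i, i2 = i + 1 := ⟨i2 - 1, by omega⟩
    have h1 : (i1, j) ∈ ν := ν.up_left_mem (Nat.lt_succ_iff.1 hi) le_rfl (hs _ _ hc)
    rw [if_pos hc, if_pos (μ.up_left_mem hi.le le_rfl hc), if_pos h1]
    split_ifs with h2
    · exact T.col_strict hi h2
    · exact Nat.lt_succ_of_le (hT _ _ h1).2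
  zeros' := fun hc => if_neg hc

theorem SemistandardYoungTableau.extend_apply {μ ν : YoungDiagram} {n : ℕ}
    (hs : ∀ i j, (i + 1, j) ∈ μ → (i, j) ∈ ν)
    (T : SemistandardYoungTableau ν) (hT : T ∈ SSYT ν n) (i j : ℕ) :
    T.extend hs hT i j = if (i, j) ∈ μ then (if (i, j) ∈ ν then T i j else n + 1) else 0 := rfl

/-- The row lengths of the part of `T` with labels at most `n`. -/
def lowerPart {n : ℕ} (f : Fin (n + 1) → ℕ) (T : ℕ → ℕ → ℕ) : Fin n → ℕ :=
  fun i => ((Finset.range (f i.castSucc)).filter fun j => T i j ≤ n).card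

theorem lt_card_filter_range {m : ℕ} {P : ℕ → Prop} [DecidablePred P]
    (hP : ∀ i j, i ≤ j → j < m → P j → P i) (j : ℕ) :
    j < ((Finset.range m).filter P).card ↔ j < m ∧ P j := by
  induction m with
  | zero => simp
  | succ m ih =>
    have ih := ih fun i j hij hj h => hP i j hij (by omega) h
    rw [Finset.range_add_one, Finset.filter_insert]
    split_ifs with h
    · have : (Finset.range m).filter P = Finset.range m := by
        rw [Finset.filter_eq_self]
        exact fun i hi => hP i m (Finset.mem_range.1 hi).le (Nat.lt_succ_self m) h
      rw [this, Finset.card_insert_of_notMem Finset.notMem_range_self, Finset.card_range]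
      exact ⟨fun hj => ⟨hj, hP j m (by omega) (Nat.lt_succ_self m) h⟩, fun hj => hj.1⟩
    · rw [ih]
      refine ⟨fun hj => ⟨by omega, hj.2⟩, fun hj => ⟨?_, hj.2⟩⟩
      have : j ≠ m := fun e => h (e ▸ hj.2)
      omega

variable {n : ℕ} {f : Fin (n + 1) → ℕ}

theorem lt_lowerPart (hf : Antitone f) (T : SemistandardYoungTableau (arrayDiagram f))
    (i : Fin n) (j : ℕ) : j < lowerPart f T i ↔ j < f i.castSucc ∧ T i j ≤ n := by
  refine lt_card_filter_range (fun a b hab hb h => ?_) j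
  refine (T.row_weak_of_le hab ?_).trans h
  exact (mem_arrayDiagram hf).2 ⟨i.castSucc.2, hb⟩

theorem lowerPart_mem_interlacing (hf : Antitone f)
    {T : SemistandardYoungTableau (arrayDiagram f)} (hT : T ∈ SSYT (arrayDiagram f) (n + 1)) :
    lowerPart f T ∈ interlacing f := by
  refine mem_interlacing.2 fun i => ⟨le_of_forall_lt fun j hj => ?_, le_of_forall_lt fun j hj => ?_⟩
  · have hc : (i.val + 1, j) ∈ arrayDiagram f := (mem_arrayDiagram hf).2 ⟨i.succ.2, hj⟩
    have h1 := T.col_strict (Nat.lt_add_one i.val) hc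
    have h2 := (hT _ _ hc).2
    exact (lt_lowerPart hf T i j).2 ⟨hj.trans_le (hf (Fin.castSucc_lt_succ (i := i)).le), by omega⟩
  · exact ((lt_lowerPart hf T i j).1 hj).1

theorem mem_arrayDiagram_lowerPart (hf : Antitone f)
    {T : SemistandardYoungTableau (arrayDiagram f)} (hT : T ∈ SSYT (arrayDiagram f) (n + 1))
    {i j : ℕ} :
    (i, j) ∈ arrayDiagram (lowerPart f T) ↔ (i, j) ∈ arrayDiagram f ∧ T i j ≤ n := by
  rw [mem_arrayDiagram (antitone_of_mem_interlacing (lowerPart_mem_interlacing hf hT))]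
  constructor
  · rintro ⟨h, hj⟩
    have := (lt_lowerPart hf T ⟨i, h⟩ j).1 hj
    exact ⟨(mem_arrayDiagram hf).2 ⟨h.trans (Nat.lt_succ_self n), this.1⟩, this.2⟩
  · rintro ⟨hc, hle⟩
    have h := succ_le_of_mem_SSYT hT hc
    have hi : i < n := by omega
    exact ⟨hi, (lt_lowerPart hf T ⟨i, hi⟩ j).2 ⟨((mem_arrayDiagram hf).1 hc).2, hle⟩⟩

theorem arrayDiagram_le_of_mem_interlacing (hf : Antitone f) {g : Fin n → ℕ}
    (hg : g ∈ interlacing f) : arrayDiagram g ≤ arrayDiagram f := by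
  rintro ⟨i, j⟩ hc
  obtain ⟨h, hj⟩ := (mem_arrayDiagram (antitone_of_mem_interlacing hg)).1 hc
  exact (mem_arrayDiagram hf).2
    ⟨h.trans (Nat.lt_succ_self n), hj.trans_le (mem_interlacing.1 hg ⟨i, h⟩).2⟩

theorem mem_arrayDiagram_of_succ_mem (hf : Antitone f) {g : Fin n → ℕ}
    (hg : g ∈ interlacing f) (i j : ℕ) (hc : (i + 1, j) ∈ arrayDiagram f) :
    (i, j) ∈ arrayDiagram g := by
  obtain ⟨h, hj⟩ := (mem_arrayDiagram hf).1 hc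
  have hi : i < n := by omega
  exact (mem_arrayDiagram (antitone_of_mem_interlacing hg)).2
    ⟨hi, hj.trans_le (mem_interlacing.1 hg ⟨i, hi⟩).1⟩

variable {R : Type*} [CommRing R]

/-- The value of the Schur polynomial `s_μ(x₁, …, xₙ)` at a point of a commutative ring. -/
noncomputable def schurEval (x : ℕ → R) (n : ℕ) (μ : YoungDiagram) : R :=
  ∑ T ∈ (SSYT_finite μ n).toFinset, ∏ c ∈ μ.cells, x (T c.1 c.2)

theorem schurEval_fiber (x : ℕ → R) (hf : Antitone f) {g : Fin n → ℕ} (hg : g ∈ interlacing f) :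
    ∑ T ∈ (SSYT_finite (arrayDiagram f) (n + 1)).toFinset.filter
        (fun T : SemistandardYoungTableau (arrayDiagram f) => lowerPart f T = g),
        ∏ c ∈ (arrayDiagram f).cells, x (T c.1 c.2) =
      x (n + 1) ^ (∑ i, f i - ∑ i, g i) * schurEval x n (arrayDiagram g) := by
  have hga := antitone_of_mem_interlacing hg
  have hle := arrayDiagram_le_of_mem_interlacing hf hg
  have hs := mem_arrayDiagram_of_succ_mem hf hg
  rw [schurEval, Finset.mul_sum]
  have hmem : ∀ {T : SemistandardYoungTableau (arrayDiagram f)},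
      T ∈ (SSYT_finite (arrayDiagram f) (n + 1)).toFinset.filter
        (fun T : SemistandardYoungTableau (arrayDiagram f) => lowerPart f T = g) →
      T ∈ SSYT (arrayDiagram f) (n + 1) ∧
      ∀ i j, (i, j) ∈ arrayDiagram g ↔ (i, j) ∈ arrayDiagram f ∧ T i j ≤ n := by
    intro T hT
    rw [Finset.mem_filter, Set.Finite.mem_toFinset] at hT
    obtain ⟨h1, rfl⟩ := hT
    exact ⟨h1, fun i j => mem_arrayDiagram_lowerPart hf h1⟩
  have hext : ∀ (T' : SemistandardYoungTableau (arrayDiagram g)) (hT' : T' ∈ SSYT _ n),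
      T'.extend hs hT' ∈ SSYT (arrayDiagram f) (n + 1) := by
    intro T' hT' i j hc
    rw [SemistandardYoungTableau.extend_apply, if_pos hc]
    split_ifs with h
    · have := hT' i j h
      omega
    · omega
  refine Finset.sum_bij' (fun T _ => T.restrict hle)
    (fun T' hT' => T'.extend hs ((Set.Finite.mem_toFinset _).1 hT')) ?_ ?_ ?_ ?_ ?_
  · intro T hT
    obtain ⟨h1, h2⟩ := hmem hT
    rw [Set.Finite.mem_toFinset]
    intro i j hc
    rw [SemistandardYoungTableau.restrict_apply, if_pos hc]
    exact ⟨(h1 i j (hle hc)).1, ((h2 i j).1 hc).2⟩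
  · intro T' hT'
    have hT'' := (Set.Finite.mem_toFinset _).1 hT'
    rw [Finset.mem_filter, Set.Finite.mem_toFinset]
    refine ⟨hext T' hT'', ?_⟩
    funext i
    refine eq_of_forall_lt_iff fun j => ?_
    rw [lt_lowerPart hf, SemistandardYoungTableau.extend_apply]
    have e1 : j < f i.castSucc ↔ (i.val, j) ∈ arrayDiagram f :=
      ⟨fun h => (mem_arrayDiagram hf).2 ⟨i.castSucc.2, h⟩, fun h => ((mem_arrayDiagram hf).1 h).2⟩
    have e2 : j < g i ↔ (i.val, j) ∈ arrayDiagram g :=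
      ⟨fun h => (mem_arrayDiagram hga).2 ⟨i.2, h⟩, fun h => ((mem_arrayDiagram hga).1 h).2⟩
    rw [e1, e2]
    constructor
    · rintro ⟨h1, h2⟩
      by_contra h3
      rw [if_pos h1, if_neg h3] at h2
      omega
    · intro h
      rw [if_pos (hle h), if_pos h]
      exact ⟨hle h, (hT'' _ _ h).2⟩
  · intro T hT
    obtain ⟨h1, h2⟩ := hmem hT
    refine SemistandardYoungTableau.ext fun i j => ?_
    rw [SemistandardYoungTableau.extend_apply, SemistandardYoungTableau.restrict_apply]
    split_ifs with h3 h4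
    · rfl
    · have := h1 i j h3
      have : ¬T i j ≤ n := fun h => h4 ((h2 i j).2 ⟨h3, h⟩)
      omega
    · exact (T.zeros h3).symm
  · intro T' hT'
    refine SemistandardYoungTableau.ext fun i j => ?_
    rw [SemistandardYoungTableau.restrict_apply, SemistandardYoungTableau.extend_apply]
    split_ifs with h1 h2
    · rfl
    · exact absurd (hle h1) h2
    · exact (T'.zeros h1).symm
  · intro T hT
    obtain ⟨h1, h2⟩ := hmem hT
    rw [← Finset.prod_sdiff (YoungDiagram.cells_subset_iff.2 hle)]
    congr 1
    · rw [← card_arrayDiagram hf, ← card_arrayDiagram hga,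
        ← Finset.card_sdiff_of_subset (YoungDiagram.cells_subset_iff.2 hle)]
      refine Finset.prod_eq_pow_card fun c hc => ?_
      rw [Finset.mem_sdiff, YoungDiagram.mem_cells, YoungDiagram.mem_cells] at hc
      have h3 := h1 c.1 c.2 hc.1
      have h4 : ¬T c.1 c.2 ≤ n := fun h => hc.2 ((h2 c.1 c.2).2 ⟨hc.1, h⟩)
      rw [show T c.1 c.2 = n + 1 by omega]
    · refine Finset.prod_congr rfl fun c hc => ?_
      rw [SemistandardYoungTableau.restrict_apply, if_pos ((YoungDiagram.mem_cells c).1 hc)]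

theorem schurEval_arrayDiagram (x : ℕ → R) {n : ℕ} {f : Fin n → ℕ} (hf : Antitone f) :
    schurEval x n (arrayDiagram f) = gelfandTsetlin x n f := by
  induction n with
  | zero =>
    have hbot : ∀ i j, (i, j) ∉ arrayDiagram f := by
      intro i j h
      exact absurd ((mem_arrayDiagram hf).1 h).1 (Nat.not_lt_zero i)
    have hcells : (arrayDiagram f).cells = ∅ :=
      Finset.eq_empty_of_forall_notMem fun c hc =>
        hbot c.1 c.2 ((YoungDiagram.mem_cells c).1 hc)
    have huniv : (SSYT_finite (arrayDiagram f) 0).toFinset =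
        {SemistandardYoungTableau.highestWeight _} := by
      ext T
      rw [Set.Finite.mem_toFinset, Finset.mem_singleton]
      refine ⟨fun _ => SemistandardYoungTableau.ext fun i j => ?_, fun _ i j h => ?_⟩
      · rw [SemistandardYoungTableau.zeros _ (hbot i j), SemistandardYoungTableau.zeros _ (hbot i j)]
      · exact absurd h (hbot i j)
    rw [schurEval, huniv, Finset.sum_singleton, hcells]
    simp [gelfandTsetlin]
  | succ n ih =>
    rw [schurEval, gelfandTsetlin, ← Finset.sum_fiberwise_of_maps_to (t := interlacing f)
      (g := fun T : SemistandardYoungTableau (arrayDiagram f) => lowerPart f T)]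
    · refine Finset.sum_congr rfl fun g hg => ?_
      rw [schurEval_fiber x hf hg, ih (antitone_of_mem_interlacing hg)]
    · intro T hT
      exact lowerPart_mem_interlacing hf ((Set.Finite.mem_toFinset _).1 hT)

end Branching

section Weights

@[to_additive]
theorem prod_cells_eq_prod_pow_tableauWt {M : Type*} [CommMonoid M] (x : ℕ → M) {n : ℕ}
    {μ : YoungDiagram} {T : SemistandardYoungTableau μ} (hT : T ∈ SSYT μ n) :
    ∏ c ∈ μ.cells, x (T c.1 c.2) = ∏ a : Fin n, x (a + 1) ^ tableauWt T (a + 1) := by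
  rw [← Finset.prod_fiberwise_of_maps_to (g := fun c => T c.1 c.2 - 1) (t := Finset.range n),
    Finset.prod_range]
  · refine Finset.prod_congr rfl fun a _ => ?_
    have : μ.cells.filter (fun c => T c.1 c.2 - 1 = a) =
        μ.cells.filter fun c => T c.1 c.2 = a + 1 := by
      refine Finset.filter_congr fun c hc => ?_
      have := hT c.1 c.2 ((YoungDiagram.mem_cells c).1 hc)
      omega
    rw [this]
    refine Finset.prod_eq_pow_card fun c hc => ?_
    rw [(Finset.mem_filter.1 hc).2]
  · intro c hc
    have := hT c.1 c.2 ((YoungDiagram.mem_cells c).1 hc)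
    rw [Finset.mem_range]
    omega

/-- The tableau whose row `i`, counted from `1`, consists of entries `i`. -/
def superstandard (μ : YoungDiagram) : SemistandardYoungTableau μ where
  entry i j := if (i, j) ∈ μ then i + 1 else 0
  row_weak' := by
    intro i j1 j2 hj hc
    rw [if_pos hc, if_pos (μ.up_left_mem le_rfl hj.le hc)]
  col_strict' := by
    intro i1 i2 j hi hc
    rw [if_pos hc, if_pos (μ.up_left_mem hi.le le_rfl hc)]
    omega
  zeros' := fun hc => if_neg hc

theorem superstandard_apply {μ : YoungDiagram} {i j : ℕ} (h : (i, j) ∈ μ) :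
    superstandard μ i j = i + 1 := if_pos h

theorem lt_of_mem_of_colLen_le {μ : YoungDiagram} {n : ℕ} (h : μ.colLen 0 ≤ n) {i j : ℕ}
    (hc : (i, j) ∈ μ) : i < n :=
  (YoungDiagram.mem_iff_lt_colLen.1 (μ.up_left_mem le_rfl (Nat.zero_le j) hc)).trans_le h

theorem superstandard_mem_SSYT {μ : YoungDiagram} {n : ℕ} (h : μ.colLen 0 ≤ n) :
    superstandard μ ∈ SSYT μ n := by
  intro i j hc
  have := lt_of_mem_of_colLen_le h hc
  rw [superstandard_apply hc]
  omega

theorem tableauWt_superstandard (μ : YoungDiagram) (a : ℕ) :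
    tableauWt (superstandard μ) (a + 1) = μ.rowLen a := by
  rw [YoungDiagram.rowLen_eq_card, YoungDiagram.row, tableauWt]
  congr 1
  refine Finset.filter_congr fun c hc => ?_
  rw [superstandard_apply ((YoungDiagram.mem_cells c).1 hc)]
  omega

/-- The sum of the row numbers, counted from `1`, of the cells of a Young diagram. -/
def rowWeight (μ : YoungDiagram) : ℕ := ∑ c ∈ μ.cells, (c.1 + 1)

theorem rowWeight_eq {μ : YoungDiagram} {n : ℕ} (h : μ.colLen 0 ≤ n) :
    rowWeight μ = ∑ a : Fin n, μ.rowLen a * (a + 1) := by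
  have := sum_cells_eq_sum_nsmul_tableauWt (fun a => a) (superstandard_mem_SSYT h)
  simp only [tableauWt_superstandard, smul_eq_mul] at this
  rw [← this]
  exact Finset.sum_congr rfl fun c hc =>
    (superstandard_apply ((YoungDiagram.mem_cells c).1 hc)).symm

theorem rowWeight_le_sum {ν : YoungDiagram} {n : ℕ} {T : SemistandardYoungTableau ν}
    (hT : T ∈ SSYT ν n) : rowWeight ν ≤ ∑ c ∈ ν.cells, T c.1 c.2 :=
  Finset.sum_le_sum fun c hc => succ_le_of_mem_SSYT hT ((YoungDiagram.mem_cells c).1 hc)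

theorem eq_superstandard {ν : YoungDiagram} {n : ℕ} {T : SemistandardYoungTableau ν}
    (hT : T ∈ SSYT ν n) (h : ∑ c ∈ ν.cells, T c.1 c.2 ≤ rowWeight ν) : T = superstandard ν := by
  have h1 := (Finset.sum_eq_sum_iff_of_le fun c hc =>
    succ_le_of_mem_SSYT hT ((YoungDiagram.mem_cells c).1 hc)).1 (le_antisymm (rowWeight_le_sum hT) h)
  refine SemistandardYoungTableau.ext fun i j => ?_
  by_cases hc : (i, j) ∈ ν
  · rw [superstandard_apply hc]
    exact (h1 (i, j) ((YoungDiagram.mem_cells _).2 hc)).symm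
  · rw [SemistandardYoungTableau.zeros _ hc, SemistandardYoungTableau.zeros _ hc]

theorem sum_eq_rowWeight {μ ν : YoungDiagram} {n : ℕ} (hμ : μ.colLen 0 ≤ n)
    {T : SemistandardYoungTableau ν} (hT : T ∈ SSYT ν n)
    (hw : ∀ a : Fin n, tableauWt T (a + 1) = μ.rowLen a) :
    ∑ c ∈ ν.cells, T c.1 c.2 = rowWeight μ := by
  rw [rowWeight_eq hμ]
  have := sum_cells_eq_sum_nsmul_tableauWt (fun a => a) hT
  simp only [hw, smul_eq_mul] at this
  exact this

theorem eq_of_tableauWt {μ ν : YoungDiagram} {n : ℕ} (hμ : μ.colLen 0 ≤ n) (hν : ν.colLen 0 ≤ n)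
    {T : SemistandardYoungTableau ν} (hT : T ∈ SSYT ν n)
    (hw : ∀ a : Fin n, tableauWt T (a + 1) = μ.rowLen a) (h : rowWeight μ ≤ rowWeight ν) :
    ν = μ := by
  have h1 := eq_superstandard hT ((sum_eq_rowWeight hμ hT hw).trans_le h)
  subst h1
  rw [← arrayDiagram_rowLen hν, ← arrayDiagram_rowLen hμ]
  congr 1
  funext a
  rw [← hw a, tableauWt_superstandard]

end Weights

section LinearIndependence

open MvPolynomial

theorem coeff_schurPoly (n : ℕ) (ν : YoungDiagram) (d : Fin n →₀ ℕ) :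
    coeff d (schurPoly n ν) =
      (((SSYT_finite ν n).toFinset.filter fun T => ∀ a : Fin n, tableauWt T (a + 1) = d a).card :
        ℤ) := by
  rw [schurPoly, coeff_sum, Finset.card_filter, Nat.cast_sum]
  refine Finset.sum_congr rfl fun T _ => ?_
  have : ∏ a : Fin n, (X a : MvPolynomial (Fin n) ℤ) ^ tableauWt T ((a : ℕ) + 1) =
      monomial (Finsupp.equivFunOnFinite.symm fun a : Fin n => tableauWt T ((a : ℕ) + 1)) 1 := by
    rw [monomial_eq, Finsupp.prod_fintype]
    · simp
    · simp
  rw [this, coeff_monomial, Nat.cast_ite, Nat.cast_one, Nat.cast_zero]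
  refine if_congr ?_ rfl rfl
  rw [Finsupp.ext_iff]
  rfl

open scoped Classical in
theorem coeff_rowLen_schurPoly {n : ℕ} {μ ν : YoungDiagram} (hμ : μ.colLen 0 ≤ n)
    (hν : ν.colLen 0 ≤ n) (h : rowWeight μ ≤ rowWeight ν) :
    coeff (Finsupp.equivFunOnFinite.symm fun a : Fin n => μ.rowLen a) (schurPoly n ν) =
      if ν = μ then 1 else 0 := by
  rw [coeff_schurPoly]
  split_ifs with hνμ
  · subst hνμ
    rw [Finset.card_eq_one.2 ⟨superstandard ν, ?_⟩, Nat.cast_one]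
    ext T
    rw [Finset.mem_filter, Set.Finite.mem_toFinset, Finset.mem_singleton]
    constructor
    · exact fun hT => eq_superstandard hT.1 (sum_eq_rowWeight hμ hT.1 hT.2).le
    · rintro rfl
      exact ⟨superstandard_mem_SSYT hμ, fun a => tableauWt_superstandard ν a⟩
  · rw [Finset.card_eq_zero.2, Nat.cast_zero]
    refine Finset.eq_empty_of_forall_notMem fun T hT => ?_
    rw [Finset.mem_filter, Set.Finite.mem_toFinset] at hT
    exact hνμ (eq_of_tableauWt hμ hν hT.1 hT.2 h)

theorem schurPoly_linearIndependent {n : ℕ} {c : YoungDiagram →₀ ℤ}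
    (hc : ∀ μ, c μ ≠ 0 → μ.colLen 0 ≤ n) (h : (c.sum fun μ a => a • schurPoly n μ) = 0) :
    c = 0 := by
  by_contra hne
  obtain ⟨μ, hμ, hmin⟩ := Finset.exists_min_image c.support rowWeight
    (Finsupp.support_nonempty_iff.2 hne)
  have hμ0 := Finsupp.mem_support_iff.1 hμ
  refine hμ0 ?_
  have h1 := congrArg (coeff (Finsupp.equivFunOnFinite.symm fun a : Fin n => μ.rowLen a)) h
  rw [Finsupp.sum, coeff_sum, coeff_zero] at h1
  rw [← h1, Finset.sum_eq_single μ]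
  · rw [coeff_smul, coeff_rowLen_schurPoly (hc μ hμ0) (hc μ hμ0) le_rfl]
    simp
  · intro ν hν hνμ
    rw [coeff_smul, coeff_rowLen_schurPoly (hc μ hμ0) (hc ν (Finsupp.mem_support_iff.1 hν))
      (hmin ν hν), if_neg hνμ, smul_zero]
  · exact fun h => absurd hμ h

theorem IsSchurExpansion.unique {n : ℕ} {f : MvPolynomial (Fin n) ℤ} {c c' : YoungDiagram →₀ ℤ}
    (hc : IsSchurExpansion n f c) (hc' : IsSchurExpansion n f c') : c' = c := by
  rw [← sub_eq_zero]
  refine schurPoly_linearIndependent (n := n) (fun μ hμ => ?_) ?_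
  · by_cases h : c μ = 0
    · refine hc'.1 μ fun h' => hμ ?_
      rw [Finsupp.sub_apply, h, h', sub_zero]
    · exact hc.1 μ h
  · rw [Finsupp.sum_sub_index fun μ a b => sub_smul a b _, ← hc.2, ← hc'.2, sub_self]

end LinearIndependence

section Specialization

open MvPolynomial

theorem aeval_schurPoly {R : Type*} [CommRing R] {n : ℕ} (x : ℕ → R) (μ : YoungDiagram) :
    aeval (fun i : Fin n => x (i + 1)) (schurPoly n μ) = schurEval x n μ := by
  rw [schurPoly, map_sum, schurEval]
  refine Finset.sum_congr rfl fun T hT => ?_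
  rw [prod_cells_eq_prod_pow_tableauWt x ((Set.Finite.mem_toFinset _).1 hT), map_prod]
  simp

/-- The variables of `schurPoly`, indexed by the labels `1, …, n` and extended by zero. -/
noncomputable def labelVar (n : ℕ) (a : ℕ) : MvPolynomial (Fin n) ℤ :=
  if h : a - 1 < n then X ⟨a - 1, h⟩ else 0

theorem labelVar_succ {n : ℕ} (i : Fin n) : labelVar n (i + 1) = X i := dif_pos i.2

theorem schurPoly_eq_schurEval (n : ℕ) (μ : YoungDiagram) :
    schurPoly n μ = schurEval (labelVar n) n μ := by
  rw [← aeval_schurPoly]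
  simp only [labelVar_succ]
  exact (aeval_X_left_apply _).symm

theorem schurBar_eq_schurEval (n : ℕ) (μ : YoungDiagram) :
    schurBar n μ = schurEval (fun a => ∑ j : Fin n, X j - labelVar n a) n μ := by
  rw [← aeval_schurPoly, schurBar]
  simp only [labelVar_succ]
  rfl

theorem schurPoly_arrayDiagram {n : ℕ} {f : Fin n → ℕ} (hf : Antitone f) :
    schurPoly n (arrayDiagram f) = gelfandTsetlin (labelVar n) n f := by
  rw [schurPoly_eq_schurEval, schurEval_arrayDiagram _ hf]

theorem antitone_rowArray (n k : ℕ) : Antitone (rowArray n k) := by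
  intro i j hij
  have : i.val ≤ j.val := hij
  simp only [rowArray]
  split_ifs <;> omega

theorem mem_rowShape {k i j : ℕ} : (i, j) ∈ rowShape k ↔ i = 0 ∧ j < k := by
  rw [← YoungDiagram.mem_cells]
  simp [rowShape, and_comm, eq_comm]

theorem mem_colShape {k i j : ℕ} : (i, j) ∈ colShape k ↔ i < k ∧ j = 0 := by
  rw [← YoungDiagram.mem_cells]
  simp [colShape, eq_comm]

theorem arrayDiagram_rowArray {n k : ℕ} (h : 0 < n ∨ k = 0) :
    arrayDiagram (rowArray n k) = rowShape k := by
  refine SetLike.ext fun c => ?_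
  rw [← Prod.mk.eta (p := c), mem_arrayDiagram (antitone_rowArray n k), mem_rowShape]
  simp only [rowArray]
  constructor
  · rintro ⟨h1, h2⟩
    split_ifs at h2 <;> omega
  · rintro ⟨h1, h2⟩
    exact ⟨by omega, by rw [if_pos h1]; exact h2⟩

theorem schurEval_rowShape {R : Type*} [CommRing R] (x : ℕ → R) {n k : ℕ} (h : 0 < n ∨ k = 0) :
    schurEval x n (rowShape k) = completeHom x n k := by
  rw [← arrayDiagram_rowArray h, schurEval_arrayDiagram x (antitone_rowArray n k)]
  cases n with
  | zero =>
    obtain rfl : k = 0 := by simpa using h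
    rw [completeHom_zero_right, gelfandTsetlin]
  | succ n => exact gelfandTsetlin_rowArray x n k

theorem schurBar_rowShape {n k : ℕ} (h : 0 < n ∨ k = 0) :
    schurBar n (rowShape k) = ∑ j ∈ Finset.range (k + 1),
      ((-1) ^ j * ((n + k - 1).choose (k - j) : ℤ)) •
        ((∑ i : Fin n, X i) ^ (k - j) * schurPoly n (rowShape j)) := by
  rw [schurBar_eq_schurEval, schurEval_rowShape _ h, completeHom_sub]
  refine Finset.sum_congr rfl fun j hj => ?_
  rw [schurPoly_eq_schurEval, schurEval_rowShape _ (h.imp_right fun h => ?_), zsmul_eq_mul]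
  · push_cast
    ring
  · rw [Finset.mem_range] at hj
    omega

end Specialization

section Expansion

open MvPolynomial

/-- `F` is an integer linear combination of Schur polynomials of partitions of `d`, in which
`s_(1^d)` has the coefficient `z`. -/
def HasExpansion (n d : ℕ) (F : MvPolynomial (Fin n) ℤ) (z : ℤ) : Prop :=
  ∃ c : YoungDiagram →₀ ℤ, (∀ μ, c μ ≠ 0 → μ.cells.card = d) ∧
    (F = c.sum fun μ a => a • schurPoly n μ) ∧ c (colShape d) = z

theorem HasExpansion.zero (n d : ℕ) : HasExpansion n d 0 0 :=
  ⟨0, by simp, by simp, rfl⟩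

theorem HasExpansion.add {n d : ℕ} {F G : MvPolynomial (Fin n) ℤ} {y z : ℤ}
    (hF : HasExpansion n d F y) (hG : HasExpansion n d G z) : HasExpansion n d (F + G) (y + z) := by
  obtain ⟨a, ha, rfl, rfl⟩ := hF
  obtain ⟨b, hb, rfl, rfl⟩ := hG
  refine ⟨a + b, fun μ hμ => ?_, ?_, rfl⟩
  · by_cases h : a μ = 0
    · refine hb μ fun h' => hμ ?_
      rw [Finsupp.add_apply, h, h', add_zero]
    · exact ha μ h
  · rw [Finsupp.sum_add_index' (h := fun μ x => x • schurPoly n μ) (fun μ => zero_smul _ _)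
      fun μ x y => add_smul x y _]

theorem HasExpansion.smul {n d : ℕ} {F : MvPolynomial (Fin n) ℤ} {z : ℤ} (m : ℤ)
    (hF : HasExpansion n d F z) : HasExpansion n d (m • F) (m * z) := by
  obtain ⟨a, ha, rfl, rfl⟩ := hF
  refine ⟨m • a, fun μ hμ => ha μ fun h => hμ ?_, ?_, rfl⟩
  · rw [Finsupp.smul_apply, h, smul_zero]
  · rw [Finsupp.sum_smul_index' (h := fun μ x => x • schurPoly n μ) fun μ => zero_smul _ _,
      Finsupp.smul_sum]
    simp only [smul_assoc]

theorem HasExpansion.sum {ι : Type*} {n d : ℕ} (s : Finset ι) {F : ι → MvPolynomial (Fin n) ℤ}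
    {z : ι → ℤ} (h : ∀ i ∈ s, HasExpansion n d (F i) (z i)) :
    HasExpansion n d (∑ i ∈ s, F i) (∑ i ∈ s, z i) := by
  classical
  induction s using Finset.induction_on with
  | empty => exact HasExpansion.zero n d
  | insert i s hi ih =>
    rw [Finset.sum_insert hi, Finset.sum_insert hi]
    exact (h i (Finset.mem_insert_self i s)).add
      (ih fun j hj => h j (Finset.mem_insert_of_mem hj))

theorem HasExpansion.schurPoly {n d : ℕ} {μ : YoungDiagram} [Decidable (μ = colShape d)]
    (h : μ.cells.card = d) :
    HasExpansion n d (schurPoly n μ) (if μ = colShape d then 1 else 0) := by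
  refine ⟨Finsupp.single μ 1, fun ν hν => ?_, ?_, ?_⟩
  · rw [Finsupp.single_apply_ne_zero] at hν
    rw [hν.1, h]
  · rw [Finsupp.sum_single_index (h := fun μ x => x • _root_.schurPoly n μ) (zero_smul _ _), one_smul]
  · rw [Finsupp.single_apply]

/-- The partition `(1^k)` as an array of length `n`. -/
def colArray (n k : ℕ) : Fin n → ℕ := fun i => if i.val < k then 1 else 0

theorem antitone_colArray (n k : ℕ) : Antitone (colArray n k) := by
  intro i j hij
  have : i.val ≤ j.val := hij
  simp only [colArray]
  split_ifs <;> omega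

theorem arrayDiagram_colArray {n k : ℕ} (h : k ≤ n) :
    arrayDiagram (colArray n k) = colShape k := by
  refine SetLike.ext fun c => ?_
  rw [← Prod.mk.eta (p := c), mem_arrayDiagram (antitone_colArray n k), mem_colShape]
  simp only [colArray]
  constructor
  · rintro ⟨h1, h2⟩
    split_ifs at h2 <;> omega
  · rintro ⟨h1, h2⟩
    exact ⟨by omega, by rw [if_pos h1]; omega⟩

theorem arrayDiagram_eq_colShape_iff {n k : ℕ} (h : k ≤ n) {f : Fin n → ℕ} (hf : Antitone f) :
    arrayDiagram f = colShape k ↔ f = colArray n k := by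
  refine ⟨fun hfk => ?_, fun hfk => by rw [hfk, arrayDiagram_colArray h]⟩
  funext i
  rw [← rowLen_arrayDiagram hf, hfk, ← arrayDiagram_colArray h,
    rowLen_arrayDiagram (antitone_colArray n k)]

theorem add_single_eq_colArray_iff {n k : ℕ} (h : k < n) {f : Fin n → ℕ} (hf : Antitone f)
    (i : Fin n) :
    f + Pi.single i 1 = colArray n (k + 1) ↔ i = ⟨k, h⟩ ∧ f = colArray n k := by
  constructor
  · intro hi
    have h1 : ∀ j, f j + (if j = i then 1 else 0) = if j.val < k + 1 then 1 else 0 := by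
      intro j
      have := congrFun hi j
      simpa only [Pi.add_apply, Pi.single_apply, colArray] using this
    have hik : i = ⟨k, h⟩ := by
      by_contra hne
      have h2 := h1 i
      have h3 := h1 ⟨k, h⟩
      rw [if_neg (Ne.symm hne), if_pos (Nat.lt_succ_self k)] at h3
      have hne' : i.val ≠ k := fun e => hne (Fin.ext e)
      rw [if_pos rfl] at h2
      split_ifs at h2 with h4
      have := hf (show i ≤ ⟨k, h⟩ from Fin.le_def.2 (by simp only; omega))
      omega
    refine ⟨hik, ?_⟩
    subst hik
    funext j
    have := h1 j
    simp only [Fin.ext_iff] at this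
    simp only [colArray]
    split_ifs at this ⊢ <;> omega
  · rintro ⟨rfl, rfl⟩
    funext j
    simp only [Pi.add_apply, Pi.single_apply, colArray, Fin.ext_iff]
    split_ifs <;> omega

theorem colLen_le_card (μ : YoungDiagram) : μ.colLen 0 ≤ μ.cells.card := by
  rw [YoungDiagram.colLen_eq_card]
  exact Finset.card_filter_le _ _

theorem HasExpansion.sum_X_mul_schurPoly {n d : ℕ} (hd : d + 1 ≤ n) {μ : YoungDiagram}
    [Decidable (μ = colShape d)] (h : μ.cells.card = d) :
    HasExpansion n (d + 1) ((∑ i : Fin n, X i) * _root_.schurPoly n μ)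
      (if μ = colShape d then 1 else 0) := by
  have hμ : arrayDiagram (fun i : Fin n => μ.rowLen i) = μ :=
    arrayDiagram_rowLen ((colLen_le_card μ).trans (by omega))
  have hf : Antitone (fun i : Fin n => μ.rowLen i) := fun i j hij => μ.rowLen_anti _ _ hij
  generalize (fun i : Fin n => μ.rowLen i) = f at hμ hf
  subst hμ
  have hpieri := sum_gelfandTsetlin_add_single (labelVar n) n hf
  simp only [labelVar_succ] at hpieri
  have hz : (if arrayDiagram f = colShape d then 1 else 0 : ℤ) =
      ∑ i, if f + Pi.single i 1 = colArray n (d + 1) then 1 else 0 := by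
    simp only [arrayDiagram_eq_colShape_iff (by omega : d ≤ n) hf, add_single_eq_colArray_iff hd hf, ite_and]
    simp
  rw [schurPoly_arrayDiagram hf, ← hpieri, hz]
  refine HasExpansion.sum _ fun i _ => ?_
  by_cases hi : Antitone (f + Pi.single i 1)
  · rw [← schurPoly_arrayDiagram hi]
    have hiff := arrayDiagram_eq_colShape_iff hd hi
    have : Decidable (arrayDiagram (f + Pi.single i 1) = colShape (d + 1)) :=
      decidable_of_iff _ hiff.symm
    rw [← if_congr hiff rfl rfl]
    refine HasExpansion.schurPoly ?_
    rw [card_arrayDiagram hf] at h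
    rw [card_arrayDiagram hi, ← h]
    simp [Finset.sum_add_distrib]
  · rw [gelfandTsetlin_eq_zero _ hi, if_neg]
    · exact HasExpansion.zero _ _
    · intro e
      exact hi (e ▸ antitone_colArray n (d + 1))

theorem HasExpansion.sum_X_mul {n d : ℕ} (hd : d + 1 ≤ n) {F : MvPolynomial (Fin n) ℤ} {z : ℤ}
    (h : HasExpansion n d F z) : HasExpansion n (d + 1) ((∑ i : Fin n, X i) * F) z := by
  classical
  obtain ⟨c, hc, rfl, rfl⟩ := h
  have hz : c (colShape d) = ∑ μ ∈ c.support, c μ * if μ = colShape d then 1 else 0 := by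
    simp
  rw [Finsupp.sum, Finset.mul_sum, hz]
  refine HasExpansion.sum _ fun μ hμ => ?_
  rw [mul_smul_comm]
  exact (HasExpansion.sum_X_mul_schurPoly hd (hc μ (Finsupp.mem_support_iff.1 hμ))).smul _

theorem HasExpansion.sum_X_pow_mul {n d : ℕ} (m : ℕ) (hd : d + m ≤ n)
    {F : MvPolynomial (Fin n) ℤ} {z : ℤ} (h : HasExpansion n d F z) :
    HasExpansion n (d + m) ((∑ i : Fin n, X i) ^ m * F) z := by
  induction m with
  | zero => simpa using h
  | succ m ih =>
    rw [pow_succ', mul_assoc]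
    exact (ih (by omega)).sum_X_mul hd

theorem HasExpansion.isSchurExpansion {n d : ℕ} (hd : d ≤ n) {F : MvPolynomial (Fin n) ℤ} {z : ℤ}
    (h : HasExpansion n d F z) :
    ∃ c, IsSchurExpansion n F c ∧ c (colShape d) = z := by
  obtain ⟨c, hc, hF, hz⟩ := h
  exact ⟨c, ⟨fun μ hμ => (colLen_le_card μ).trans ((hc μ hμ).trans_le hd), hF⟩, hz⟩

theorem rowShape_eq_colShape_iff (j : ℕ) : rowShape j = colShape j ↔ j ≤ 1 := by
  constructor
  · intro h
    by_contra hj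
    have : (0, 1) ∈ rowShape j := mem_rowShape.2 ⟨rfl, by omega⟩
    rw [h, mem_colShape] at this
    omega
  · intro h
    refine SetLike.ext fun c => ?_
    rw [← Prod.mk.eta (p := c), mem_rowShape, mem_colShape]
    omega

theorem hasExpansion_schurBar_rowShape {n k : ℕ} (hk : k ≤ n) :
    HasExpansion n k (schurBar n (rowShape k))
      (∑ j ∈ Finset.range (k + 1),
        (-1) ^ j * ((n + k - 1).choose (k - j) : ℤ) * if j ≤ 1 then 1 else 0) := by
  classical
  rw [schurBar_rowShape (by omega)]
  refine HasExpansion.sum _ fun j hj => ?_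
  have hj' : j ≤ k := Nat.lt_succ_iff.1 (Finset.mem_range.1 hj)
  have h1 : HasExpansion n j (_root_.schurPoly n (rowShape j)) (if j ≤ 1 then 1 else 0) := by
    simp only [← rowShape_eq_colShape_iff]
    exact HasExpansion.schurPoly (by simp [rowShape])
  have h2 := h1.sum_X_pow_mul (k - j) (by omega)
  rw [Nat.add_sub_cancel' hj'] at h2
  exact h2.smul _

theorem sum_choose_mul_indicator (m k : ℕ) :
    (∑ j ∈ Finset.range (k + 1 + 1),
      (-1) ^ j * (m.choose (k + 1 - j) : ℤ) * if j ≤ 1 then 1 else 0) =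
      m.choose (k + 1) - m.choose k := by
  rw [Finset.sum_range_succ', Finset.sum_range_succ', Finset.sum_eq_zero]
  · simp
    ring
  · intro j _
    rw [if_neg (by omega), mul_zero]

end Expansion

section Count

theorem ncard_rowTableaux {n k p : ℕ} (h : 2 ≤ n ∨ k = 0) :
    {S ∈ SSYT (rowShape k) n | (0 < k → 1 < S 0 0) ∧
      ∀ i : ℕ, 1 ≤ i → i < k → (S 0 (i - 1), S 0 i) ≠ (p + i, p + i)}.ncard =
      (avoidingSeqs k (n - 2) 2 (p + 1)).ncard := by
  have hinj : Function.Injective fun (S : SemistandardYoungTableau (rowShape k)) (j : ℕ) =>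
      S 0 j := by
    intro S S' hS
    refine SemistandardYoungTableau.ext fun i j => ?_
    rcases i with _ | i
    · exact congrFun hS j
    · have : (i + 1, j) ∉ rowShape k := by simp [mem_rowShape]
      rw [S.zeros this, S'.zeros this]
  rw [← Set.ncard_image_of_injective _ hinj]
  congr 1
  ext f
  constructor
  · rintro ⟨S, ⟨hS, h1, h2⟩, rfl⟩
    refine ⟨fun i hi => ?_, fun i hi => ?_, fun i hi => ?_, fun i hi => ?_⟩
    · have h3 := hS 0 i (mem_rowShape.2 ⟨rfl, hi⟩)
      have h4 := S.row_weak_of_le (Nat.zero_le i) (mem_rowShape.2 ⟨rfl, hi⟩)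
      have h5 := h1 (by omega)
      simp only
      omega
    · exact S.row_weak (Nat.lt_add_one i) (mem_rowShape.2 ⟨rfl, hi⟩)
    · exact S.zeros fun hc => absurd (mem_rowShape.1 hc).2 (by omega)
    · have := h2 (i + 1) (by omega) hi
      rw [Nat.add_sub_cancel, Ne, Prod.mk.injEq] at this
      rwa [add_assoc, add_comm 1 i]
  · intro hf
    have hmono : ∀ {i j : ℕ}, i ≤ j → j < k → f i ≤ f j := by
      intro i j hij
      induction j, hij using Nat.le_induction with
      | base => exact fun _ => le_rfl
      | succ j _ ih => exact fun hj => (ih (by omega)).trans (hf.2.1 j hj)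
    let S : SemistandardYoungTableau (rowShape k) :=
      { entry := fun i j => if (i, j) ∈ rowShape k then f j else 0
        row_weak' := by
          intro i j1 j2 hj hc
          rw [if_pos hc, if_pos ((rowShape k).up_left_mem le_rfl hj.le hc)]
          exact hmono hj.le (mem_rowShape.1 hc).2
        col_strict' := by
          intro i1 i2 j hi hc
          have := (mem_rowShape.1 hc).1
          omega
        zeros' := fun hc => if_neg hc }
    have hS : ∀ i j, S i j = if (i, j) ∈ rowShape k then f j else 0 := fun _ _ => rfl
    have hS0 : ∀ j, S 0 j = f j := by
      intro j
      rw [hS]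
      split_ifs with hc
      · rfl
      · exact (hf.2.2.1 j (by by_contra hj; exact hc (mem_rowShape.2 ⟨rfl, by omega⟩))).symm
    refine ⟨S, ⟨fun i j hc => ?_, fun hk => ?_, fun i hi hik => ?_⟩, funext hS0⟩
    · obtain ⟨rfl, hj⟩ := mem_rowShape.1 hc
      have := hf.1 j hj
      rw [hS0]
      omega
    · rw [hS0]
      exact (hf.1 0 hk).1
    · obtain ⟨i, rfl⟩ : ∃ j, i = j + 1 := ⟨i - 1, by omega⟩
      have := hf.2.2.2 i hik
      rw [Nat.add_sub_cancel, hS0, hS0, Ne, Prod.mk.injEq]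
      rwa [add_assoc, add_comm 1 i] at this

theorem ncard_rowTableaux_eq {n k p : ℕ} (hk : k ≤ n) (hp : 1 ≤ p) (hpn : p ≤ n - k + 1) :
    (({S ∈ SSYT (rowShape k) n | (0 < k → 1 < S 0 0) ∧
      ∀ i : ℕ, 1 ≤ i → i < k → (S 0 (i - 1), S 0 i) ≠ (p + i, p + i)}.ncard : ℕ) : ℤ) =
      ∑ j ∈ Finset.range (k + 1),
        (-1) ^ j * ((n + k - 1).choose (k - j) : ℤ) * if j ≤ 1 then 1 else 0 := by
  rcases k with _ | k
  · rw [ncard_rowTableaux (Or.inr rfl), avoidingSeqs_zero]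
    simp
  rw [sum_choose_mul_indicator]
  by_cases hn : 2 ≤ n
  · rw [ncard_rowTableaux (Or.inl hn)]
    obtain ⟨b, rfl⟩ := Nat.exists_eq_add_of_le hn
    have h := (ncard_avoidingSeqs (k + 1) b 2 (p + 1) (by omega)).2
    rw [show 2 - (p + 1) = 0 by omega] at h
    rw [show 2 + b - 2 = b by omega, show 2 + b + (k + 1) - 1 = k + 1 + b + 1 by omega]
    rcases k with _ | k
    · simp only [excludedCount] at h
      simp at h ⊢
      omega
    · simp only [excludedCount] at h
      rw [if_pos (by omega), show k + 1 + 1 - 2 - 0 = k by omega] at h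
      rw [Nat.choose_succ_succ (k + 1 + 1 + b) (k + 1), Nat.choose_succ_succ (k + 1 + 1 + b) k]
      simp only [Nat.succ_eq_add_one]
      push_cast
      omega
  · obtain rfl : k = 0 := by omega
    obtain rfl : n = 1 := by omega
    rw [Set.eq_empty_of_forall_notMem (s := {S ∈ SSYT (rowShape (0 + 1)) 1 | _}), Set.ncard_empty]
    · simp
    · rintro S ⟨hS, h1, -⟩
      have := hS 0 0 (mem_rowShape.2 ⟨rfl, Nat.lt_succ_self 0⟩)
      have := h1 (Nat.lt_succ_self 0)
      omega

end Count

theorem corollary3p7 (n k p : ℕ) (hk : k ≤ n) (hp : 1 ≤ p) (hpn : p ≤ n - k + 1) :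
    ∃ c : YoungDiagram →₀ ℤ,
      IsSchurExpansion n (schurBar n (rowShape k)) c ∧
      (∀ c' : YoungDiagram →₀ ℤ, IsSchurExpansion n (schurBar n (rowShape k)) c' → c' = c) ∧
      c (colShape k) =
        (({S ∈ SSYT (rowShape k) n |
            (0 < k → 1 < S 0 0) ∧
            ∀ i : ℕ, 1 ≤ i → i < k → (S 0 (i - 1), S 0 i) ≠ (p + i, p + i)}.ncard : ℕ) : ℤ) := by
  obtain ⟨c, hc, hz⟩ := (hasExpansion_schurBar_rowShape hk).isSchurExpansion hk
  refine ⟨c, hc, fun c' hc' => hc.unique hc', ?_⟩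
  rw [hz, ncard_rowTableaux_eq hk hp hpn]
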